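/- All graphs are finite and simple. For a vertex $v$ of a graph $G$, the card $G-v$ is the subgraph of $G$ induced on $V(G)\setminus\{v\}$, and the deck of $G$ is the multiset of all its cards, each taken up to isomorphism. Theorem 3. Let $G$ be a graph on $n\ge 7$ vertices, let $\ell$ be the number of vertices of maximum degree in $G$, and let $r\ge 0$ be an integer with $r\ne n-\ell$. Then the number of subgraphs of $G$ isomorphic to the complete graph $K_r$ can be reconstructed from any $n-1$ cards of the deck of $G$. That is, if $H$ is any graph on $n$ vertices whose deck also contains these $n-1$ cards (counted with multiplicity), then $H$ and $G$ have the same number of $K_r$ subgraphs. -/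

import Mathlib

/-- The card `G - v`: the subgraph of `G` induced on all vertices other than `v`. -/
def SimpleGraph.vertexCard {V : Type*} (G : SimpleGraph V) (v : V) :
    SimpleGraph ({v}ᶜ : Set V) :=
  G.induce {v}ᶜ

/-- The family `C` consists of `k` cards of the deck of `G`: the deck is the multiset of the
cards `G - v`, taken up to isomorphism, so the members of `C` must be isomorphic to the cards
`G - v` at `k` pairwise distinct vertices `v`. -/
def SimpleGraph.AreCardsOf {V : Type*} {k m : ℕ} (C : Fin k → SimpleGraph (Fin m))
    (G : SimpleGraph V) : Prop :=
  ∃ f : Fin k ↪ V, ∀ i, Nonempty (C i ≃g G.vertexCard (f i))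

/-- The number of `K_r` subgraphs of `G`, that is, of sets of `r` pairwise adjacent vertices. -/
def SimpleGraph.cliqueCount {V : Type*} [Fintype V] [DecidableEq V] (G : SimpleGraph V)
    [DecidableRel G.Adj] (r : ℕ) : ℕ :=
  (G.cliqueFinset r).card

/-- The number of vertices of maximum degree in `G`. -/
def SimpleGraph.numMaxDegree {V : Type*} [Fintype V] (G : SimpleGraph V)
    [DecidableRel G.Adj] : ℕ :=
  (Finset.univ.filter fun v => G.degree v = G.maxDegree).card

/-! ### Two graphs on one vertex set with matching cards -/

namespace SimpleGraph

open scoped Finset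

/-! Place `G` and `H` on one vertex set so that the cards match at every vertex except `v`, and let
`δ` be the difference of their `K_r` counts. A card counts the cliques avoiding its vertex, so the
number of `r`-cliques through each `x ≠ v` also differs by exactly `δ`; double counting then gives
the difference `(r - (n - 1)) * δ` at `v` (`CardsAgreeOff.cliqueCountAt_sub`,
`CardsAgreeOff.cliqueCountAt_sub_self`).

For `r = 2` these are degrees. A nonzero `δ` would shift all degrees off `v` by one and move that of
`v` by `n - 3`; counting degree classes in the cards excludes this for `n ≥ 7`. Hence all degrees
agree (`CardsAgreeOff.degree_eq`).

Let `Δ` be the maximum degree. The vertices of degree `Δ` in the card at `x` are the nonneighbors of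
`x` of degree `Δ`, and every clique through them is visible there. If `δ > 0`, a vertex of degree
`Δ` with the most cliques in `G` is matched, through a card, with a vertex having as many cliques in
`H`, hence more in `G`: a contradiction, unless the match is `v`.

If `v` itself has degree `Δ`, the clique counts at the `ℓ` vertices of degree `Δ` differ in total by
`(r + ℓ - n) * δ`, which is where `r ≠ n - ℓ` enters. This forces all nonneighbors of `v` to have
degree `Δ`, and the extremal argument is restricted to vertices lacking that property. When it has
no candidates, a single card determines the graph (`CardsAgreeOff.cliqueCount_eq_of_nonneighbors`).
The values `Δ = n - 1` and `Δ = n - 2` need separate arguments, partly by induction on `r`. -/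

/-- The cards of `G` and `H` at every vertex other than `v` are isomorphic, each isomorphism being
recorded as a permutation of `V` fixing the deleted vertex. -/
def CardsAgreeOff {V : Type*} (G H : SimpleGraph V) (v : V) : Prop :=
  ∀ x, x ≠ v → ∃ φ : Equiv.Perm V, φ x = x ∧
    ∀ a b, a ≠ x → b ≠ x → (G.Adj a b ↔ H.Adj (φ a) (φ b))

theorem CardsAgreeOff.symm {V : Type*} {G H : SimpleGraph V} {v : V} (h : G.CardsAgreeOff H v) :
    H.CardsAgreeOff G v := by
  intro x hx
  obtain ⟨φ, hφ, hadj⟩ := h x hx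
  have hne : ∀ a, a ≠ x → φ.symm a ≠ x := by
    intro a ha h0
    apply ha
    rw [← hφ, ← h0, Equiv.apply_symm_apply]
  refine ⟨φ.symm, by rw [Equiv.symm_apply_eq, hφ], fun a b ha hb => ?_⟩
  rw [hadj _ _ (hne a ha) (hne b hb)]
  simp

theorem isNClique_map_perm {V : Type*} {G H : SimpleGraph V} {x : V} {φ : Equiv.Perm V}
    (hadj : ∀ a b, a ≠ x → b ≠ x → (G.Adj a b ↔ H.Adj (φ a) (φ b))) {r : ℕ} {s : Finset V}
    (hx : x ∉ s) : H.IsNClique r (s.map φ.toEmbedding) ↔ G.IsNClique r s := by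
  simp only [isNClique_iff, Finset.card_map, isClique_iff, Set.Pairwise]
  refine and_congr_left fun _ => ⟨fun h a ha b hb hab => ?_, fun h a ha b hb hab => ?_⟩
  · rw [hadj a b (fun e => hx (e ▸ ha)) (fun e => hx (e ▸ hb))]
    exact h (by simpa using ha) (by simpa using hb) (by simpa using hab)
  · simp only [Finset.coe_map, Set.mem_image, Finset.mem_coe, Equiv.coe_toEmbedding] at ha hb
    obtain ⟨a, ha, rfl⟩ := ha
    obtain ⟨b, hb, rfl⟩ := hb
    rw [← hadj a b (fun e => hx (e ▸ ha)) (fun e => hx (e ▸ hb))]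
    exact h ha hb (fun e => hab (e ▸ rfl))

/-! ### Cliques and degrees read from a card -/

variable {V : Type*} [Fintype V] [DecidableEq V]

/-- The number of `r`-cliques of `G` through the vertex `u`. -/
def cliqueCountAt (G : SimpleGraph V) [DecidableRel G.Adj] (r : ℕ) (u : V) : ℕ :=
  {s ∈ G.cliqueFinset r | u ∈ s}.card

variable (G H : SimpleGraph V) [DecidableRel G.Adj] [DecidableRel H.Adj]

theorem sum_cliqueCountAt (r : ℕ) : ∑ u, G.cliqueCountAt r u = r * G.cliqueCount r := by
  unfold cliqueCountAt cliqueCount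
  simp_rw [Finset.card_filter]
  rw [Finset.sum_comm, mul_comm, ← smul_eq_mul, ← Finset.sum_const]
  refine Finset.sum_congr rfl fun s hs => ?_
  rw [mem_cliqueFinset_iff] at hs
  simp [hs.card_eq]

theorem card_clique_avoid_add (r : ℕ) (x : V) :
    {s ∈ G.cliqueFinset r | x ∉ s}.card + G.cliqueCountAt r x = G.cliqueCount r := by
  unfold cliqueCountAt cliqueCount
  rw [add_comm, Finset.card_filter_add_card_filter_not]

variable {G H}

theorem card_clique_avoid_congr {x : V} {φ : Equiv.Perm V} (hφ : φ x = x)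
    (hadj : ∀ a b, a ≠ x → b ≠ x → (G.Adj a b ↔ H.Adj (φ a) (φ b))) (r : ℕ)
    (P Q : Finset V → Prop) [DecidablePred P] [DecidablePred Q]
    (hPQ : ∀ s, P s ↔ Q (s.map φ.toEmbedding)) :
    {s ∈ G.cliqueFinset r | x ∉ s ∧ P s}.card = {s ∈ H.cliqueFinset r | x ∉ s ∧ Q s}.card := by
  have hmem : ∀ s : Finset V, x ∉ s.map φ.toEmbedding ↔ x ∉ s := by
    intro s
    rw [← Finset.mem_map' φ.toEmbedding (a := x) (s := s)]
    simp [hφ]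
  refine Finset.card_equiv (Equiv.finsetCongr φ) fun s => ?_
  simp only [Finset.mem_filter, mem_cliqueFinset_iff, Equiv.finsetCongr_apply, hmem, ← hPQ]
  constructor
  · rintro ⟨h1, h2, h3⟩
    exact ⟨(isNClique_map_perm hadj h2).2 h1, h2, h3⟩
  · rintro ⟨h1, h2, h3⟩
    exact ⟨(isNClique_map_perm hadj h2).1 h1, h2, h3⟩

/-- The numbers of cliques through the vertices other than `v` shift by a constant. -/
theorem CardsAgreeOff.cliqueCountAt_add {v : V} (h : G.CardsAgreeOff H v) (r : ℕ) {x : V}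
    (hx : x ≠ v) :
    G.cliqueCountAt r x + H.cliqueCount r = H.cliqueCountAt r x + G.cliqueCount r := by
  obtain ⟨φ, hφ, hadj⟩ := h x hx
  have h1 := card_clique_avoid_congr hφ hadj r (fun _ => True) (fun _ => True) (fun _ => Iff.rfl)
  simp only [and_true] at h1
  have h2 := card_clique_avoid_add G r x
  have h3 := card_clique_avoid_add H r x
  omega

theorem CardsAgreeOff.cliqueCountAt_sub {v : V} (h : G.CardsAgreeOff H v) (r : ℕ) {x : V}
    (hx : x ≠ v) :
    (G.cliqueCountAt r x : ℤ) - H.cliqueCountAt r x = G.cliqueCount r - H.cliqueCount r := by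
  have := h.cliqueCountAt_add r hx
  omega

/-- Summed over all vertices, the local differences give `r` times the global one; the `n - 1`
vertices other than `v` contribute one global difference each. -/
theorem CardsAgreeOff.cliqueCountAt_sub_self {v : V} (h : G.CardsAgreeOff H v) (r : ℕ) :
    (G.cliqueCountAt r v : ℤ) - H.cliqueCountAt r v =
      (r - (Fintype.card V - 1)) * (G.cliqueCount r - H.cliqueCount r) := by
  have h1 : (∑ u, (G.cliqueCountAt r u : ℤ)) = r * G.cliqueCount r := by
    exact_mod_cast sum_cliqueCountAt G r
  have h2 : (∑ u, (H.cliqueCountAt r u : ℤ)) = r * H.cliqueCount r := by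
    exact_mod_cast sum_cliqueCountAt H r
  have h3 : ∑ u ∈ Finset.univ.erase v, ((G.cliqueCountAt r u : ℤ) - H.cliqueCountAt r u) =
      (Fintype.card V - 1) * (G.cliqueCount r - H.cliqueCount r) := by
    rw [Finset.sum_congr rfl fun u hu => h.cliqueCountAt_sub r (Finset.ne_of_mem_erase hu),
      Finset.sum_const, Finset.card_erase_of_mem (Finset.mem_univ v), Finset.card_univ,
      nsmul_eq_mul, Nat.cast_sub (Fintype.card_pos_iff.2 ⟨v⟩)]
    simp
  have h4 := Finset.add_sum_erase Finset.univ
    (fun u => (G.cliqueCountAt r u : ℤ) - H.cliqueCountAt r u) (Finset.mem_univ v)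
  rw [h3, Finset.sum_sub_distrib, h1, h2] at h4
  linear_combination h4

/-- In the card at `x`, the cliques through `u` avoid `x`; if `x` is not adjacent to `u`, these are
all cliques through `u`. -/
theorem cliqueCountAt_eq_card_avoid {r : ℕ} {u x : V} (hux : u ≠ x) (hadj : ¬ G.Adj u x) :
    {s ∈ G.cliqueFinset r | x ∉ s ∧ u ∈ s}.card = G.cliqueCountAt r u := by
  unfold cliqueCountAt
  congr 1
  refine Finset.filter_congr fun s hs => ?_
  rw [mem_cliqueFinset_iff] at hs
  refine ⟨fun h => h.2, fun h => ⟨fun hx => hadj ?_, h⟩⟩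
  exact hs.isClique h hx hux

theorem card_clique_through_congr {x u : V} {φ : Equiv.Perm V} (hφ : φ x = x)
    (hadj : ∀ a b, a ≠ x → b ≠ x → (G.Adj a b ↔ H.Adj (φ a) (φ b))) (r : ℕ) :
    {s ∈ G.cliqueFinset r | x ∉ s ∧ u ∈ s}.card =
      {s ∈ H.cliqueFinset r | x ∉ s ∧ φ u ∈ s}.card :=
  card_clique_avoid_congr hφ hadj r (u ∈ ·) (φ u ∈ ·) fun s => by simp

theorem degree_eq_card_erase_add (x u : V) :
    G.degree u = ((G.neighborFinset u).erase x).card + if G.Adj u x then 1 else 0 := by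
  rw [← card_neighborFinset_eq_degree]
  split_ifs with h
  · exact (Finset.card_erase_add_one (by simpa using h)).symm
  · rw [Finset.erase_eq_of_notMem (by simpa using h), add_zero]

theorem card_neighbor_erase_congr {x u : V} {φ : Equiv.Perm V} (hφ : φ x = x)
    (hadj : ∀ a b, a ≠ x → b ≠ x → (G.Adj a b ↔ H.Adj (φ a) (φ b))) (hu : u ≠ x) :
    ((G.neighborFinset u).erase x).card = ((H.neighborFinset (φ u)).erase x).card := by
  refine Finset.card_equiv φ fun z => ?_
  have hz : φ z = x ↔ z = x := by rw [← φ.apply_eq_iff_eq (x := z) (y := x), hφ]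
  simp only [Finset.mem_erase, mem_neighborFinset, ne_eq, hz]
  exact and_congr_right fun h => hadj u z hu h

theorem cliqueCount_zero : G.cliqueCount 0 = 1 := by
  rw [cliqueCount, Finset.card_eq_one]
  refine ⟨∅, ?_⟩
  ext s
  simp only [mem_cliqueFinset_iff, isNClique_iff, Finset.card_eq_zero, Finset.mem_singleton,
    and_iff_right_iff_imp]
  rintro rfl
  simp

theorem cliqueCountAt_succ (r : ℕ) (u : V) :
    G.cliqueCountAt (r + 1) u = {s ∈ G.cliqueFinset r | ∀ z ∈ s, G.Adj u z}.card := by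
  unfold cliqueCountAt
  refine Finset.card_bij' (fun s _ => s.erase u) (fun s _ => insert u s) ?_ ?_ ?_ ?_
  · intro s hs
    simp only [Finset.mem_filter, mem_cliqueFinset_iff] at hs ⊢
    refine ⟨hs.1.erase_of_mem hs.2, fun z hz => ?_⟩
    rw [Finset.mem_erase] at hz
    exact hs.1.isClique hs.2 hz.2 (Ne.symm hz.1)
  · intro s hs
    simp only [Finset.mem_filter, mem_cliqueFinset_iff] at hs ⊢
    exact ⟨hs.1.insert hs.2, Finset.mem_insert_self _ _⟩
  · intro s hs
    simp only [Finset.mem_filter] at hs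
    exact Finset.insert_erase hs.2
  · intro s hs
    simp only [Finset.mem_filter] at hs
    exact Finset.erase_insert fun h => G.loopless.irrefl _ (hs.2 u h)

theorem cliqueCountAt_two (u : V) : G.cliqueCountAt 2 u = G.degree u := by
  rw [cliqueCountAt_succ, ← card_neighborFinset_eq_degree]
  refine (Finset.card_nbij (fun z => {z}) ?_ ?_ ?_).symm
  · intro z hz
    have : G.Adj u z := by simpa using hz
    simp [this, isNClique_iff]
  · intro a _ b _ hab
    simpa using hab
  · intro s hs
    simp only [Finset.coe_filter, mem_cliqueFinset_iff, Set.mem_ofPred_eq] at hs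
    obtain ⟨z, rfl⟩ := Finset.card_eq_one.1 hs.1.card_eq
    exact ⟨z, by simpa using hs.2 z (by simp), rfl⟩

theorem cliqueCountAt_succ_add_of_dominating {r : ℕ} {u : V} (hu : ∀ z, z ≠ u → G.Adj u z) :
    G.cliqueCountAt (r + 1) u + G.cliqueCountAt r u = G.cliqueCount r := by
  rw [cliqueCountAt_succ, ← card_clique_avoid_add G r u]
  congr 2
  refine Finset.filter_congr fun s _ => ⟨fun h hs => G.loopless.irrefl _ (h u hs), fun h z hz => ?_⟩
  exact hu z fun e => h (e ▸ hz)

/-- Removing `u` from an `(r + 1)`-clique leaves an `r`-clique avoiding `u` and `z`. No clique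
contains both, so the `r`-cliques split into those through `u`, those through `z` and the rest. -/
theorem cliqueCountAt_succ_add_of_unique_nonneighbor {r : ℕ} {u z : V} (hzu : z ≠ u)
    (hz : ¬ G.Adj u z) (hu : ∀ y, y ≠ u → y ≠ z → G.Adj u y) :
    G.cliqueCountAt (r + 1) u + G.cliqueCountAt r u + G.cliqueCountAt r z = G.cliqueCount r := by
  have h1 : G.cliqueCountAt (r + 1) u = {s ∈ G.cliqueFinset r | z ∉ s ∧ u ∉ s}.card := by
    rw [cliqueCountAt_succ]
    congr 1
    refine Finset.filter_congr fun s _ => ⟨fun h => ⟨fun hs => hz (h z hs),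
      fun hs => G.loopless.irrefl _ (h u hs)⟩, fun h y hy => ?_⟩
    exact hu y (fun e => h.2 (e ▸ hy)) fun e => h.1 (e ▸ hy)
  have h2 := cliqueCountAt_eq_card_avoid (r := r) (Ne.symm hzu) hz
  have h3 := Finset.card_filter_add_card_filter_not (s := {s ∈ G.cliqueFinset r | z ∉ s}) (u ∈ ·)
  rw [Finset.filter_filter, Finset.filter_filter] at h3
  have h4 := card_clique_avoid_add G r z
  omega

/-! ### Equality of the degrees -/

theorem card_nonneighbor_add_degree (u : V) :
    #{x | x ≠ u ∧ ¬ G.Adj u x} + G.degree u + 1 = Fintype.card V := by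
  have h1 := G.degree_compl u
  have h2 := G.degree_lt_card_verts u
  have h3 : Gᶜ.degree u = #{x | x ≠ u ∧ ¬ G.Adj u x} := by
    rw [← card_neighborFinset_eq_degree]
    congr 1
    ext x
    simp [compl_adj, eq_comm]
  omega

/-- For a vertex other than the exceptional one, the numbers of vertices of a given degree in the
two cards agree. -/
theorem CardsAgreeOff.card_filter_card_erase {v : V} (h : G.CardsAgreeOff H v) {x : V}
    (hx : x ≠ v) (P : ℕ → Prop) [DecidablePred P] :
    #{u | u ≠ x ∧ P ((G.neighborFinset u).erase x).card} =
      #{u | u ≠ x ∧ P ((H.neighborFinset u).erase x).card} := by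
  obtain ⟨φ, hφ, hadj⟩ := h x hx
  refine Finset.card_equiv φ fun u => ?_
  have hz : φ u = x ↔ u = x := by rw [← φ.apply_eq_iff_eq (x := u) (y := x), hφ]
  simp only [Finset.mem_filter, Finset.mem_univ, true_and, ne_eq, hz]
  refine and_congr_right fun hu => ?_
  rw [card_neighbor_erase_congr hφ hadj hu]

/-- Count the vertices of degree at least `k` in the card at `x`. In `G` these have degree above
`k`, or are nonneighbors of degree `k`; in `H` they have degree at least `k` but are not neighbors
of degree `k`. The shift by one cancels the main terms everywhere except at `v`. -/
theorem CardsAgreeOff.card_nonneighbor_add_card_neighbor {v : V} (h : G.CardsAgreeOff H v)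
    (hdeg : ∀ x, x ≠ v → G.degree x = H.degree x + 1) (hv : G.degree v ≤ H.degree v) {x : V}
    (hx : x ≠ v) (k : ℕ) :
    #{u | u ≠ x ∧ ¬ G.Adj u x ∧ G.degree u = k} + #{u | H.Adj u x ∧ H.degree u = k} =
      if G.degree v ≤ k ∧ k ≤ H.degree v then 1 else 0 := by
  have hsum : ∀ (P : V → Prop) [DecidablePred P], (#{u | u ≠ x ∧ P u} : ℤ) =
      ∑ u ∈ Finset.univ.erase x, if P u then 1 else 0 := by
    intro P _
    rw [← Finset.filter_filter, Finset.filter_ne', Finset.card_filter]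
    push_cast
    rfl
  have h0 := congrArg (Nat.cast (R := ℤ)) (h.card_filter_card_erase hx (k ≤ ·))
  rw [hsum, hsum] at h0
  have hG := hsum fun u => ¬ G.Adj u x ∧ G.degree u = k
  have hH' : #{u | u ≠ x ∧ H.Adj u x ∧ H.degree u = k} = #{u | H.Adj u x ∧ H.degree u = k} := by
    congr 1
    ext u
    simp only [Finset.mem_filter, Finset.mem_univ, true_and, and_iff_right_iff_imp]
    exact fun h => h.1.ne
  have hH := hsum fun u => H.Adj u x ∧ H.degree u = k
  rw [hH'] at hH
  have e1 : ∀ u, ((if k ≤ ((G.neighborFinset u).erase x).card then 1 else 0 : ℤ) =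
      (if k + 1 ≤ G.degree u then 1 else 0) + if ¬ G.Adj u x ∧ G.degree u = k then 1 else 0) := by
    intro u
    have := degree_eq_card_erase_add (G := G) x u
    by_cases hA : G.Adj u x <;> simp only [hA, if_true, if_false, not_true, not_false_iff,
      true_and, false_and] at this ⊢ <;> split_ifs <;> first | rfl | omega
  have e2 : ∀ u, ((if k ≤ ((H.neighborFinset u).erase x).card then 1 else 0 : ℤ) =
      (if k ≤ H.degree u then 1 else 0) - if H.Adj u x ∧ H.degree u = k then 1 else 0) := by
    intro u
    have := degree_eq_card_erase_add (G := H) x u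
    by_cases hA : H.Adj u x <;> simp only [hA, if_true, if_false, true_and,
      false_and] at this ⊢ <;> split_ifs <;> first | rfl | omega
  have e3 : (∑ u ∈ Finset.univ.erase x, ((if k ≤ H.degree u then 1 else 0 : ℤ) -
      if k + 1 ≤ G.degree u then 1 else 0)) =
      (if k ≤ H.degree v then 1 else 0) - if k + 1 ≤ G.degree v then 1 else 0 := by
    refine Finset.sum_eq_single_of_mem v (by simpa using Ne.symm hx) fun u _ hu => ?_
    have := hdeg u hu
    split_ifs <;> first | rfl | omega
  simp only [e1, e2, Finset.sum_add_distrib, Finset.sum_sub_distrib] at h0 e3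
  apply Nat.cast_injective (R := ℤ)
  rw [Nat.cast_add, hG, hH, Nat.cast_ite, Nat.cast_one, Nat.cast_zero]
  have e4 : (if G.degree v ≤ k ∧ k ≤ H.degree v then 1 else 0 : ℤ) =
      (if k ≤ H.degree v then 1 else 0) - if k + 1 ≤ G.degree v then 1 else 0 := by
    split_ifs <;> first | rfl | omega
  rw [e4]
  linarith

/-- Summation of the previous identity over all cards. -/
theorem CardsAgreeOff.degree_class_identity {v : V} (h : G.CardsAgreeOff H v)
    (hdeg : ∀ x, x ≠ v → G.degree x = H.degree x + 1) (hv : G.degree v ≤ H.degree v) {k : ℕ}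
    (hk : G.degree v ≤ k) (hk' : k ≤ H.degree v) :
    ((Fintype.card V : ℤ) - 2 - k) * #{u | u ≠ v ∧ G.degree u = k}
      + #{u | u ≠ v ∧ G.degree u = k ∧ G.Adj u v}
      + (if G.degree v = k then (Fintype.card V : ℤ) - 1 - k else 0)
      + (((k : ℤ) - 1) * #{u | u ≠ v ∧ G.degree u = k + 1}
      + #{u | u ≠ v ∧ H.degree u = k ∧ ¬ H.Adj u v}
      + if H.degree v = k then (k : ℤ) else 0) = Fintype.card V - 1 := by
  have hsum : ∀ (P : V → Prop) [DecidablePred P], (#{u | u ≠ v ∧ P u} : ℤ) =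
      ∑ u ∈ Finset.univ.erase v, if P u then 1 else 0 := by
    intro P _
    rw [← Finset.filter_filter, Finset.filter_ne', Finset.card_filter]
    push_cast
    rfl
  have hall : (∑ x ∈ Finset.univ.erase v,
      ((#{u | u ≠ x ∧ ¬ G.Adj u x ∧ G.degree u = k} : ℤ) +
        #{u | H.Adj u x ∧ H.degree u = k})) = Fintype.card V - 1 := by
    rw [Finset.sum_congr rfl (g := fun _ => (1 : ℤ)), Finset.sum_const,
      Finset.card_erase_of_mem (Finset.mem_univ v), Finset.card_univ, nsmul_eq_mul,
      Nat.cast_sub (Fintype.card_pos_iff.2 ⟨v⟩)]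
    · simp
    · intro x hx
      have := h.card_nonneighbor_add_card_neighbor hdeg hv (Finset.ne_of_mem_erase hx) k
      rw [if_pos ⟨hk, hk'⟩] at this
      exact_mod_cast this
  rw [Finset.sum_add_distrib] at hall
  -- After exchanging the sums, `u` is counted once for each of its nonneighbors in `G`, or
  -- neighbors in `H`, other than `v`.
  have hG : ∀ u, (∑ x ∈ Finset.univ.erase v, (if u ≠ x ∧ ¬ G.Adj u x then 1 else 0 : ℤ)) =
      Fintype.card V - 1 - G.degree u - if u ≠ v ∧ ¬ G.Adj u v then 1 else 0 := by
    intro u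
    have h1 := card_nonneighbor_add_degree (G := G) u
    rw [Finset.card_filter] at h1
    have h2 := Finset.add_sum_erase Finset.univ
      (fun x => (if u ≠ x ∧ ¬ G.Adj u x then 1 else 0 : ℤ)) (Finset.mem_univ v)
    zify at h1
    simp only [ne_comm (b := u)] at h1
    linarith
  have hH : ∀ u, (∑ x ∈ Finset.univ.erase v, (if H.Adj u x then 1 else 0 : ℤ)) =
      H.degree u - if H.Adj u v then 1 else 0 := by
    intro u
    have h1 : (H.degree u : ℤ) = ∑ x, if H.Adj u x then 1 else 0 := by
      rw [← card_neighborFinset_eq_degree, neighborFinset_eq_filter, Finset.card_filter]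
      push_cast
      rfl
    have h2 := Finset.add_sum_erase Finset.univ
      (fun x => (if H.Adj u x then 1 else 0 : ℤ)) (Finset.mem_univ v)
    linarith
  have hG' : (∑ x ∈ Finset.univ.erase v,
      (#{u | u ≠ x ∧ ¬ G.Adj u x ∧ G.degree u = k} : ℤ)) =
      ∑ u, if G.degree u = k then
        (Fintype.card V - 1 - G.degree u - if u ≠ v ∧ ¬ G.Adj u v then 1 else 0 : ℤ) else 0 := by
    simp only [Finset.card_filter]
    push_cast
    rw [Finset.sum_comm]
    refine Finset.sum_congr rfl fun u _ => ?_
    rw [← hG u]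
    split_ifs with hu <;> simp [hu]
  have hH' : (∑ x ∈ Finset.univ.erase v, (#{u | H.Adj u x ∧ H.degree u = k} : ℤ)) =
      ∑ u, if H.degree u = k then (H.degree u - if H.Adj u v then 1 else 0 : ℤ) else 0 := by
    simp only [Finset.card_filter]
    push_cast
    rw [Finset.sum_comm]
    refine Finset.sum_congr rfl fun u _ => ?_
    rw [← hH u]
    split_ifs with hu <;> simp [hu]
  rw [hG', hH', ← Finset.add_sum_erase Finset.univ _ (Finset.mem_univ v),
    ← Finset.add_sum_erase Finset.univ _ (Finset.mem_univ v)] at hall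
  rw [hsum, hsum, hsum, hsum, Finset.mul_sum, Finset.mul_sum, ← Finset.sum_add_distrib,
    ← Finset.sum_add_distrib]
  have t1 : (∑ u ∈ Finset.univ.erase v, (((Fintype.card V : ℤ) - 2 - k) *
      (if G.degree u = k then 1 else 0) + if G.degree u = k ∧ G.Adj u v then 1 else 0)) =
      ∑ u ∈ Finset.univ.erase v, if G.degree u = k then
        (Fintype.card V - 1 - G.degree u - if u ≠ v ∧ ¬ G.Adj u v then 1 else 0 : ℤ) else 0 := by
    refine Finset.sum_congr rfl fun u hu => ?_
    have hu := Finset.ne_of_mem_erase hu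
    by_cases h1 : G.degree u = k <;> by_cases h2 : G.Adj u v <;> simp [h1, h2, hu] <;> ring
  have t2 : (∑ u ∈ Finset.univ.erase v, (((k : ℤ) - 1) *
      (if G.degree u = k + 1 then 1 else 0) + if H.degree u = k ∧ ¬ H.Adj u v then 1 else 0)) =
      ∑ u ∈ Finset.univ.erase v, if H.degree u = k then
        (H.degree u - if H.Adj u v then 1 else 0 : ℤ) else 0 := by
    refine Finset.sum_congr rfl fun u hu => ?_
    rw [hdeg u (Finset.ne_of_mem_erase hu)]
    by_cases h1 : H.degree u = k <;> by_cases h2 : H.Adj u v <;> simp [h1, h2]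
  rw [t1, t2]
  have t3 : (if G.degree v = k then (Fintype.card V : ℤ) - 1 - k else 0) =
      if G.degree v = k then
        (Fintype.card V - 1 - G.degree v - if v ≠ v ∧ ¬ G.Adj v v then 1 else 0 : ℤ) else 0 := by
    split_ifs with h1 <;> simp_all
  have t4 : (if H.degree v = k then (k : ℤ) else 0) =
      if H.degree v = k then (H.degree v - if H.Adj v v then 1 else 0 : ℤ) else 0 := by
    split_ifs with h1 <;> simp_all
  rw [t3, t4]
  linarith

theorem card_filter_degree_adj_add_le (G : SimpleGraph V) [DecidableRel G.Adj] (v : V) {j k : ℕ}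
    (hjk : j ≠ k) :
    #{u | u ≠ v ∧ G.degree u = j ∧ G.Adj u v} + #{u | u ≠ v ∧ G.degree u = k ∧ G.Adj u v} ≤
      G.degree v := by
  rw [← card_neighborFinset_eq_degree, ← Finset.card_union_of_disjoint]
  · refine Finset.card_le_card fun u hu => ?_
    simp only [Finset.mem_union, Finset.mem_filter, Finset.mem_univ, true_and] at hu
    rw [mem_neighborFinset]
    rcases hu with hu | hu <;> exact hu.2.2.symm
  · rw [Finset.disjoint_filter]
    rintro u - ⟨_, h1, _⟩ ⟨_, h2, _⟩
    omega

theorem card_filter_degree_not_adj_add_le (G : SimpleGraph V) [DecidableRel G.Adj] (v : V)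
    {j k : ℕ} (hjk : j ≠ k) :
    #{u | u ≠ v ∧ G.degree u = j ∧ ¬ G.Adj u v} + #{u | u ≠ v ∧ G.degree u = k ∧ ¬ G.Adj u v}
      + G.degree v + 1 ≤ Fintype.card V := by
  have h1 := card_nonneighbor_add_degree (G := G) v
  rw [← Finset.card_union_of_disjoint]
  · rw [← h1]
    refine Nat.succ_le_succ (Nat.add_le_add_right (Finset.card_le_card fun u hu => ?_) _)
    simp only [Finset.mem_union, Finset.mem_filter, Finset.mem_univ, true_and,
      G.adj_comm u v] at hu ⊢
    tauto
  · rw [Finset.disjoint_filter]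
    rintro u - ⟨_, h1, _⟩ ⟨_, h2, _⟩
    omega

/-- The numerical consequences of the degree class identities: `b k` vertices have degree `k` in
one graph, `p k` of them being adjacent and `q (k - 1)` of them nonadjacent to the exceptional
vertex. -/
theorem eq_seven_of_degree_class_identity {m : ℕ} {b p q : ℕ → ℕ} {d d' : ℕ}
    (hid : ∀ k k' j a X Y, k = j + 1 → k' = j + 2 → m + 7 = a + j + 3 → d ≤ k → k ≤ d' →
      X = (if d = k then a + 1 else 0) → Y = (if d' = k then k else 0) →
      a * b k + p k + X + (j * b k' + q k + Y) = a + j + 2)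
    (hp : ∀ j k, j ≠ k → p j + p k ≤ d) (hq : ∀ j k, j ≠ k → q j + q k + d' + 1 ≤ m + 7)
    (hpb : ∀ k, p k ≤ b k) (hqb : ∀ k, q k ≤ b (k + 1)) (hd : d' = d + m + 4) (hd2 : d ≤ 2) :
    m = 0 ∧ d = 1 ∧ q 1 = 1 ∧ (b 2 = 2 ∧ b 3 = 0 ∨ b 2 = 1 ∧ b 4 = 0) := by
  -- The products `a * b k` are nonlinear for `omega`; lower bounds on them are supplied by hand.
  have hmul := fun c t => fun h : t ≤ b c => fun a => Nat.mul_le_mul_left a h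
  subst hd
  have hd : d = 0 ∨ d = 1 ∨ d = 2 := by omega
  rcases hd with rfl | rfl | rfl
  · exfalso
    have i1 := hid 1 2 0 (m + 4) 0 0 rfl rfl (by omega) (by omega) (by omega)
      (if_neg (by omega)).symm (if_neg (by omega)).symm
    have i2 := hid 2 3 1 (m + 3) 0 0 rfl rfl (by omega) (by omega) (by omega)
      (if_neg (by omega)).symm (if_neg (by omega)).symm
    have p12 := hp 1 2 (by omega)
    have p34 := hp 3 4 (by omega)
    have q12 := hq 1 2 (by omega)
    have q13 := hq 1 3 (by omega)
    have q14 := hq 1 4 (by omega)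
    have qb : q 1 ≤ b 2 := hqb 1
    simp only [zero_mul] at i1
    have hb1 : b 1 = 1 := by
      rcases Nat.lt_or_ge (b 1) 2 with h | h
      · rcases Nat.lt_or_ge (b 1) 1 with h' | h'
        · rw [Nat.lt_one_iff.1 h'] at i1
          omega
        · omega
      · have := hmul _ _ h (m + 4)
        omega
    rw [hb1] at i1
    have hb2 : 2 ≤ b 2 := by omega
    have := hmul _ _ hb2 (m + 3)
    -- Here `b 2 ≥ 2` gives `2 * (m + 3) ≤ m + 6`. Only seven vertices remain, and the identities
    -- for `k = 3, 4` then clash.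
    obtain rfl : m = 0 := by omega
    have i3 := hid 3 4 2 2 0 0 rfl rfl (by omega) (by omega) (by omega)
      (if_neg (by omega)).symm (if_neg (by omega)).symm
    have i4 := hid 4 5 3 1 0 4 rfl rfl (by omega) (by omega) (by omega)
      (if_neg (by omega)).symm (if_pos (by omega)).symm
    omega
  · have i1 := hid 1 2 0 (m + 4) (m + 5) 0 rfl rfl (by omega) (by omega) (by omega)
      (if_pos (by omega)).symm (if_neg (by omega)).symm
    have i2 := hid 2 3 1 (m + 3) 0 0 rfl rfl (by omega) (by omega) (by omega)
      (if_neg (by omega)).symm (if_neg (by omega)).symm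
    have i3 := hid 3 4 2 (m + 2) 0 0 rfl rfl (by omega) (by omega) (by omega)
      (if_neg (by omega)).symm (if_neg (by omega)).symm
    have i4 := hid (m + 5) (m + 6) (m + 4) 0 0 (m + 5) rfl rfl (by omega) (by omega) (by omega)
      (if_neg (by omega)).symm (if_pos (by omega)).symm
    have p1 := hp 1 (m + 5) (by omega)
    have p2 := hp 2 (m + 5) (by omega)
    have p3 := hp 3 (m + 5) (by omega)
    have q1 := hq 1 (m + 5) (by omega)
    have q2 := hq 1 2 (by omega)
    have q3 := hq 1 3 (by omega)
    have pb := hpb 1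
    have qb : q 1 ≤ b 2 := hqb 1
    simp only [zero_mul, one_mul] at i1 i2 i4
    have hb1 : b 1 = 0 := by
      rcases Nat.eq_zero_or_pos (b 1) with h | h
      · exact h
      · have := hmul _ _ h (m + 4)
        omega
    rw [hb1] at i1
    have hb6 : b (m + 6) = 0 := by
      rcases Nat.eq_zero_or_pos (b (m + 6)) with h | h
      · exact h
      · have := hmul _ _ h (m + 4)
        omega
    rw [hb6] at i4
    have hb2 : b 2 = 1 ∨ b 2 = 2 := by
      rcases Nat.lt_or_ge (b 2) 3 with h | h
      · omega
      · have := hmul _ _ h (m + 3)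
        omega
    rcases hb2 with hb2 | hb2
    · rw [hb2] at i2
      have hb3 : b 3 = 3 := by omega
      rw [hb3] at i3
      exact ⟨by omega, rfl, by omega, Or.inr ⟨hb2, by omega⟩⟩
    · rw [hb2] at i2
      exact ⟨by omega, rfl, by omega, Or.inl ⟨hb2, by omega⟩⟩
  · exfalso
    have i1 := hid (m + 5) (m + 6) (m + 4) 0 0 0 rfl rfl (by omega) (by omega) (by omega)
      (if_neg (by omega)).symm (if_neg (by omega)).symm
    have i2 := hid (m + 4) (m + 5) (m + 3) 1 0 0 rfl rfl (by omega) (by omega) (by omega)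
      (if_neg (by omega)).symm (if_neg (by omega)).symm
    have q1 := hq (m + 5) (m + 4) (by omega)
    have p1 := hp (m + 5) (m + 4) (by omega)
    have pb := hpb (m + 5)
    simp only [zero_mul] at i1
    have hb1 : b (m + 6) = 1 := by
      rcases Nat.lt_or_ge (b (m + 6)) 2 with h | h
      · rcases Nat.lt_or_ge (b (m + 6)) 1 with h' | h'
        · rw [Nat.lt_one_iff.1 h'] at i1
          omega
        · omega
      · have := hmul _ _ h (m + 4)
        omega
    rw [hb1] at i1
    have hb2 : 2 ≤ b (m + 5) := by omega
    have := hmul _ _ hb2 (m + 3)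
    obtain rfl : m = 0 := by omega
    have i3 := hid 3 4 2 2 0 0 rfl rfl (by omega) (by omega) (by omega)
      (if_neg (by omega)).symm (if_neg (by omega)).symm
    have i4 := hid 2 3 1 3 4 0 rfl rfl (by omega) (by omega) (by omega)
      (if_pos (by omega)).symm (if_neg (by omega)).symm
    have p2 := hp 5 3 (by omega)
    have p3 := hp 5 2 (by omega)
    have q2 := hq 2 3 (by omega)
    norm_num at i1 i2 p1 q1 pb hb2
    omega

/-- The degree sequences of `G` and `H` cannot differ by one away from `v`. -/
theorem CardsAgreeOff.false_of_degree_eq_add_one {v : V} (h : G.CardsAgreeOff H v)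
    (hn : 7 ≤ Fintype.card V) (hdeg : ∀ x, x ≠ v → G.degree x = H.degree x + 1)
    (hv : H.degree v + 3 = G.degree v + Fintype.card V) : False := by
  have hlt := H.degree_lt_card_verts v
  obtain ⟨m, hm⟩ := Nat.exists_eq_add_of_le' hn
  have hpb : ∀ k, #{u | u ≠ v ∧ G.degree u = k ∧ G.Adj u v} ≤ #{u | u ≠ v ∧ G.degree u = k} :=
    fun k => Finset.card_le_card fun u hu => by
      simp only [Finset.mem_filter] at hu ⊢
      tauto
  have hqb : ∀ k, #{u | u ≠ v ∧ H.degree u = k ∧ ¬ H.Adj u v} ≤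
      #{u | u ≠ v ∧ G.degree u = k + 1} := fun k => Finset.card_le_card fun u hu => by
    simp only [Finset.mem_filter, Finset.mem_univ, true_and] at hu ⊢
    exact ⟨hu.1, by rw [hdeg u hu.1, hu.2.1]⟩
  -- With `m = n - 7`, the coefficients `n - 2 - k` and `k - 1` become the natural numbers `a` and
  -- `j`, avoiding truncated subtraction.
  have key := eq_seven_of_degree_class_identity (m := m) (d := G.degree v) (d' := H.degree v)
    (fun k k' j a X Y hk hk' hja h1 h2 hX hY => by
      have := h.degree_class_identity hdeg (by omega) h1 h2
      have ha : ((m + 7 : ℕ) : ℤ) = ((a + j + 3 : ℕ) : ℤ) := by rw [hja]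
      rw [hm, ha] at this
      subst hk hk' hX hY
      apply Nat.cast_injective (R := ℤ)
      push_cast at this ⊢
      split_ifs at this ⊢ <;> linarith)
    (fun j k => G.card_filter_degree_adj_add_le v)
    (fun j k hjk => by
      rw [← hm]
      exact H.card_filter_degree_not_adj_add_le v hjk) hpb hqb (by omega) (by omega)
  obtain ⟨rfl, hd, hq1, hb⟩ := key
  have hd' : H.degree v = 5 := by omega
  have hloc : ∀ x, x ≠ v → ∀ k, 1 ≤ k → k ≤ 5 → #{u | u ≠ x ∧ ¬ G.Adj u x ∧ G.degree u = k} +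
      #{u | H.Adj u x ∧ H.degree u = k} = 1 := fun x hx k h1 h2 => by
    rw [h.card_nonneighbor_add_card_neighbor hdeg (by omega) hx k, if_pos (by omega)]
  rw [Finset.card_eq_one] at hq1
  obtain ⟨y, hy⟩ := hq1
  have hy' := Finset.ext_iff.1 hy
  simp only [Finset.mem_filter, Finset.mem_univ, true_and, Finset.mem_singleton] at hy'
  obtain ⟨hyv, hy1, hyadj⟩ := (hy' y).2 rfl
  -- If no vertex off `v` has `G`-degree `k`, the local identity leaves only an `H`-neighbor of
  -- degree `k`. The bound `3 ≤ k` excludes `v`, whose `G`-degree is 1.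
  have hempty : ∀ k, 3 ≤ k → #{u | u ≠ v ∧ G.degree u = k} = 0 → ∀ x, x ≠ v → k ≤ 5 →
      ∃ u, H.Adj u x ∧ H.degree u = k := by
    intro k h1 h2 x hx h3
    have h4 := hloc x hx k (by omega) h3
    have h5 : #{u | u ≠ x ∧ ¬ G.Adj u x ∧ G.degree u = k} = 0 := by
      rw [Finset.card_eq_zero, Finset.filter_eq_empty_iff] at h2 ⊢
      rintro u - ⟨_, _, h8⟩
      refine h2 (Finset.mem_univ u) ⟨?_, h8⟩
      rintro rfl
      omega
    have h6 : 0 < #{u | H.Adj u x ∧ H.degree u = k} := by omega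
    rw [Finset.card_pos] at h6
    obtain ⟨u, hu⟩ := h6
    exact ⟨u, by simpa using hu⟩
  have huniq : ∀ x, H.degree x = 1 → ∀ a b, H.Adj a x → H.Adj b x → a = b := by
    intro x hx a b ha hb
    rw [← card_neighborFinset_eq_degree] at hx
    exact Finset.card_le_one.1 hx.le a (by simpa using ha.symm) b (by simpa using hb.symm)
  rcases hb with ⟨hb2, hb3⟩ | ⟨hb2, hb4⟩
  -- The second vertex `u` of `G`-degree 2 is an `H`-leaf attached to `v`, yet it needs an
  -- `H`-neighbor of degree 3, while `v` has degree 5.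
  · obtain ⟨u, hu, huy⟩ := Finset.exists_mem_ne (by omega) y (s := {u | u ≠ v ∧ G.degree u = 2})
    simp only [Finset.mem_filter, Finset.mem_univ, true_and] at hu
    have hu1 : H.degree u = 1 := by
      have := hdeg u hu.1
      omega
    have huv : H.Adj u v := by
      by_contra hc
      exact huy ((hy' u).1 ⟨hu.1, hu1, hc⟩)
    obtain ⟨z, hz, hz3⟩ := hempty 3 le_rfl hb3 u hu.1 (by omega)
    have := huniq u hu1 z v hz huv.symm
    subst this
    omega
  -- The `H`-leaf `y` would need neighbors of degree 4 and of degree 2.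
  · obtain ⟨z, hz, hz4⟩ := hempty 4 (by omega) hb4 y hyv (by omega)
    have h4 := hloc y hyv 2 (by omega) (by omega)
    have h5 : #{u | u ≠ y ∧ ¬ G.Adj u y ∧ G.degree u = 2} = 0 := by
      rw [Finset.card_eq_zero, Finset.filter_eq_empty_iff]
      rintro u - ⟨h6, _, h8⟩
      refine h6 (Finset.card_le_one.1 hb2.le u ?_ y ?_)
      · simp only [Finset.mem_filter, Finset.mem_univ, true_and]
        refine ⟨?_, h8⟩
        rintro rfl
        omega
      · simp only [Finset.mem_filter, Finset.mem_univ, true_and]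
        have := hdeg y hyv
        exact ⟨hyv, by omega⟩
    have h6 : 0 < #{u | H.Adj u y ∧ H.degree u = 2} := by omega
    rw [Finset.card_pos] at h6
    obtain ⟨t, ht⟩ := h6
    simp only [Finset.mem_filter, Finset.mem_univ, true_and] at ht
    have := huniq y hy1 z t hz ht.1
    subst this
    omega

theorem CardsAgreeOff.cliqueCount_two_le {v : V} (h : G.CardsAgreeOff H v)
    (hn : 7 ≤ Fintype.card V) : G.cliqueCount 2 ≤ H.cliqueCount 2 := by
  by_contra! hlt
  have h1 := h.cliqueCountAt_sub_self 2
  have h2 := fun x hx => h.cliqueCountAt_add 2 (x := x) hx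
  simp only [cliqueCountAt_two] at h1 h2
  have h3 := H.degree_lt_card_verts v
  obtain ⟨κ, hκ⟩ := Nat.exists_eq_add_of_lt hlt
  rw [hκ] at h1
  push_cast at h1
  -- The edge counts differ by `κ + 1`, so the degrees of `v` differ by `(n - 3) * (κ + 1)`, which
  -- exceeds `n - 1` once `κ ≥ 1`.
  have hκ0 : κ = 0 := by
    by_contra h0
    have : (1 : ℤ) ≤ κ := by exact_mod_cast Nat.one_le_iff_ne_zero.2 h0
    have hn' : (7 : ℤ) ≤ Fintype.card V := by exact_mod_cast hn
    have h3' : (H.degree v : ℤ) < Fintype.card V := by exact_mod_cast h3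
    nlinarith
  subst hκ0
  refine h.false_of_degree_eq_add_one hn (fun x hx => ?_) ?_
  · have := h2 x hx
    omega
  · push_cast at h1
    ring_nf at h1
    omega

theorem CardsAgreeOff.degree_eq {v : V} (h : G.CardsAgreeOff H v)
    (hn : 7 ≤ Fintype.card V) (x : V) : G.degree x = H.degree x := by
  have h0 : G.cliqueCount 2 = H.cliqueCount 2 :=
    le_antisymm (h.cliqueCount_two_le hn) (h.symm.cliqueCount_two_le hn)
  rcases eq_or_ne x v with rfl | hx
  · have := h.cliqueCountAt_sub_self 2
    simp only [cliqueCountAt_two, h0, sub_self, mul_zero] at this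
    omega
  · have := h.cliqueCountAt_add 2 hx
    simp only [cliqueCountAt_two] at this
    omega

/-! ### Isomorphism invariance, and maximum-degree vertices seen in a card -/

theorem cliqueCount_congr {V W : Type*} [Fintype V] [DecidableEq V] [Fintype W] [DecidableEq W]
    {G : SimpleGraph V} {H : SimpleGraph W} [DecidableRel G.Adj] [DecidableRel H.Adj]
    (e : G ≃g H) (r : ℕ) : G.cliqueCount r = H.cliqueCount r := by
  refine Finset.card_equiv (Equiv.finsetCongr e.toEquiv) fun s => ?_
  simp only [mem_cliqueFinset_iff, Equiv.finsetCongr_apply, isNClique_iff, Finset.card_map,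
    isClique_iff, Set.Pairwise]
  refine and_congr_left fun _ => ⟨fun h a ha b hb hab => ?_, fun h a ha b hb hab => ?_⟩
  · simp only [Finset.coe_map, Set.mem_image, Finset.mem_coe, Equiv.coe_toEmbedding] at ha hb
    obtain ⟨a, ha, rfl⟩ := ha
    obtain ⟨b, hb, rfl⟩ := hb
    exact e.map_adj_iff.2 (h ha hb fun hc => hab (hc ▸ rfl))
  · refine e.map_adj_iff.1 (h ?_ ?_ ?_)
    · simpa using ha
    · simpa using hb
    · simpa using hab

/-- The nonneighbors of `x` of degree `Δ`. -/
def nonneighborsOfDegree (G : SimpleGraph V) [DecidableRel G.Adj] (Δ : ℕ) (x : V) : Finset V :=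
  {u | u ≠ x ∧ ¬ G.Adj u x ∧ G.degree u = Δ}

variable {Δ : ℕ} {v : V}

theorem mem_nonneighborsOfDegree {u x : V} :
    u ∈ G.nonneighborsOfDegree Δ x ↔ u ≠ x ∧ ¬ G.Adj u x ∧ G.degree u = Δ := by
  simp [nonneighborsOfDegree]

theorem card_nonneighborsOfDegree_le (x : V) :
    #(G.nonneighborsOfDegree Δ x) + G.degree x + 1 ≤ Fintype.card V := by
  rw [← card_nonneighbor_add_degree (G := G) x]
  refine Nat.succ_le_succ (Nat.add_le_add_right (Finset.card_le_card fun u hu => ?_) _)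
  rw [mem_nonneighborsOfDegree] at hu
  simpa using ⟨hu.1, fun h => hu.2.1 h.symm⟩

/-- This turns "all nonneighbors have degree `Δ`" into a cardinality, which transfers between `G`
and `H`. -/
theorem card_nonneighborsOfDegree_eq_iff (x : V) :
    #(G.nonneighborsOfDegree Δ x) + G.degree x + 1 = Fintype.card V ↔
      ∀ z, z ≠ x → ¬ G.Adj z x → G.degree z = Δ := by
  have hsub : G.nonneighborsOfDegree Δ x ⊆
      Finset.univ.filter fun u => u ≠ x ∧ ¬ G.Adj x u := fun u hu => by
    rw [mem_nonneighborsOfDegree] at hu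
    simpa using ⟨hu.1, fun h => hu.2.1 h.symm⟩
  rw [← card_nonneighbor_add_degree (G := G) x, add_left_inj, add_left_inj]
  constructor
  · intro h z hz hzx
    have h1 := Finset.eq_of_subset_of_card_le hsub h.ge
    have h2 : z ∈ G.nonneighborsOfDegree Δ x := by
      rw [h1]
      simpa using ⟨hz, fun h => hzx h.symm⟩
    exact (mem_nonneighborsOfDegree.1 h2).2.2
  · intro h
    refine le_antisymm (Finset.card_le_card hsub) (Finset.card_le_card fun z hz => ?_)
    simp only [Finset.mem_filter, Finset.mem_univ, true_and, G.adj_comm x z] at hz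
    exact mem_nonneighborsOfDegree.2 ⟨hz.1, hz.2, h z hz.1 hz.2⟩

theorem sum_nonneighborsOfDegree (f : V → V → ℕ) :
    ∑ x, ∑ u ∈ G.nonneighborsOfDegree Δ x, f u x =
      ∑ u with G.degree u = Δ, ∑ x with x ≠ u ∧ ¬ G.Adj u x, f u x := by
  refine Finset.sum_comm' fun x u => ?_
  simp only [mem_nonneighborsOfDegree, Finset.mem_filter, Finset.mem_univ, true_and]
  rw [ne_comm]
  tauto

/-- A vertex of degree `Δ` has exactly `D` nonneighbors, so it is counted `D` times. -/
theorem sum_card_filter_nonneighborsOfDegree {D : ℕ} (hD : D + Δ + 1 = Fintype.card V)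
    (P : V → Prop) [DecidablePred P] :
    ∑ x, #{u ∈ G.nonneighborsOfDegree Δ x | P u} = D * #{u | G.degree u = Δ ∧ P u} := by
  simp only [Finset.card_filter _ (G.nonneighborsOfDegree Δ _)]
  rw [sum_nonneighborsOfDegree fun u _ => if P u then 1 else 0, ← Finset.filter_filter,
    Finset.card_filter, Finset.mul_sum]
  refine Finset.sum_congr rfl fun u hu => ?_
  have h1 := card_nonneighbor_add_degree (G := G) u
  rw [(Finset.mem_filter.1 hu).2] at h1
  rw [Finset.sum_const, smul_eq_mul]
  congr 1
  omega

/-- A nonneighbor of `x` of maximum degree keeps its degree and its cliques in the card at `x`. -/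
theorem mem_nonneighborsOfDegree_of_perm (hG : ∀ u, G.degree u ≤ Δ)
    (hH : ∀ u, H.degree u ≤ Δ) {x : V} {φ : Equiv.Perm V} (hφ : φ x = x)
    (hadj : ∀ a b, a ≠ x → b ≠ x → (G.Adj a b ↔ H.Adj (φ a) (φ b))) (u : V) :
    u ∈ G.nonneighborsOfDegree Δ x ↔ φ u ∈ H.nonneighborsOfDegree Δ x := by
  have hx : φ u = x ↔ u = x := by rw [← φ.apply_eq_iff_eq (x := u) (y := x), hφ]
  simp only [mem_nonneighborsOfDegree, ne_eq, hx]
  refine and_congr_right fun hu => ?_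
  have h1 := degree_eq_card_erase_add (G := G) x u
  have h2 := degree_eq_card_erase_add (G := H) x (φ u)
  rw [← card_neighbor_erase_congr hφ hadj hu] at h2
  have h3 := hG u
  have h4 := hH (φ u)
  split_ifs at h1 h2 with h5 h6 <;> constructor <;> rintro ⟨_, _⟩ <;>
    first | contradiction | exact ⟨‹_›, by omega⟩ | (exfalso; omega)

theorem cliqueCountAt_perm_of_mem (hG : ∀ u, G.degree u ≤ Δ)
    (hH : ∀ u, H.degree u ≤ Δ) {x : V} {φ : Equiv.Perm V} (hφ : φ x = x)
    (hadj : ∀ a b, a ≠ x → b ≠ x → (G.Adj a b ↔ H.Adj (φ a) (φ b))) (r : ℕ) {u : V}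
    (hu : u ∈ G.nonneighborsOfDegree Δ x) : H.cliqueCountAt r (φ u) = G.cliqueCountAt r u := by
  have hu' := (mem_nonneighborsOfDegree_of_perm hG hH hφ hadj u).1 hu
  rw [mem_nonneighborsOfDegree] at hu hu'
  rw [← cliqueCountAt_eq_card_avoid hu.1 hu.2.1, ← cliqueCountAt_eq_card_avoid hu'.1 hu'.2.1,
    card_clique_through_congr hφ hadj]

theorem CardsAgreeOff.card_filter_nonneighborsOfDegree (h : G.CardsAgreeOff H v)
    (hG : ∀ u, G.degree u ≤ Δ) (hH : ∀ u, H.degree u ≤ Δ) (r : ℕ) (P : ℕ → Prop)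
    [DecidablePred P] {x : V} (hx : x ≠ v) :
    #{u ∈ G.nonneighborsOfDegree Δ x | P (G.cliqueCountAt r u)} =
      #{u ∈ H.nonneighborsOfDegree Δ x | P (H.cliqueCountAt r u)} := by
  obtain ⟨φ, hφ, hadj⟩ := h x hx
  refine Finset.card_equiv φ fun u => ?_
  rw [Finset.mem_filter, Finset.mem_filter, ← mem_nonneighborsOfDegree_of_perm hG hH hφ hadj]
  refine and_congr_right fun hu => ?_
  rw [cliqueCountAt_perm_of_mem hG hH hφ hadj r hu]

/-- For `x ≠ v` the card at `x` shows this number. At `v` it follows by subtraction, since the total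
over all vertices depends only on the degrees. -/
theorem CardsAgreeOff.card_nonneighborsOfDegree (h : G.CardsAgreeOff H v)
    (hdeg : ∀ x, G.degree x = H.degree x) (hG : ∀ u, G.degree u ≤ Δ) (x : V) :
    #(G.nonneighborsOfDegree Δ x) = #(H.nonneighborsOfDegree Δ x) := by
  have hH : ∀ u, H.degree u ≤ Δ := fun u => hdeg u ▸ hG u
  have hne : ∀ x, x ≠ v → #(G.nonneighborsOfDegree Δ x) = #(H.nonneighborsOfDegree Δ x) := by
    intro x hx
    simpa using h.card_filter_nonneighborsOfDegree hG hH 0 (fun _ => True) hx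
  rcases ne_or_eq x v with hx | rfl
  · exact hne x hx
  rcases Nat.lt_or_ge Δ (Fintype.card V) with hΔ | hΔ
  · obtain ⟨D, hD⟩ : ∃ D, D + Δ + 1 = Fintype.card V := ⟨Fintype.card V - Δ - 1, by omega⟩
    have h1 := sum_card_filter_nonneighborsOfDegree (G := G) hD fun _ => True
    have h2 := sum_card_filter_nonneighborsOfDegree (G := H) hD fun _ => True
    simp only [Finset.filter_true, and_true] at h1 h2
    simp only [hdeg] at h1
    rw [← h2, ← Finset.add_sum_erase _ _ (Finset.mem_univ x),
      ← Finset.add_sum_erase _ _ (Finset.mem_univ x), Finset.sum_congr rfl fun y hy =>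
        hne y (Finset.ne_of_mem_erase hy)] at h1
    exact Nat.add_right_cancel h1
  · have hemp : ∀ (K : SimpleGraph V) [DecidableRel K.Adj], K.nonneighborsOfDegree Δ x = ∅ := by
      intro K _
      refine Finset.eq_empty_of_forall_notMem fun u hu => ?_
      have := K.degree_lt_card_verts u
      rw [(mem_nonneighborsOfDegree.1 hu).2.2] at this
      omega
    rw [hemp, hemp]

/-! ### Clique counts, by the degree of `v` and the size of `Δ` -/

/-- If some vertex of maximum degree other than `v` has only nonneighbors of maximum degree, then
its card determines the graph. -/
theorem CardsAgreeOff.cliqueCount_eq_of_nonneighbors (h : G.CardsAgreeOff H v)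
    (hdeg : ∀ x, G.degree x = H.degree x) (hG : ∀ u, G.degree u ≤ Δ) {u : V} (hu : u ≠ v)
    (hnon : ∀ z, z ≠ u → ¬ G.Adj z u → G.degree z = Δ) (r : ℕ) :
    G.cliqueCount r = H.cliqueCount r := by
  have hH : ∀ u, H.degree u ≤ Δ := fun u => hdeg u ▸ hG u
  have hnon' : ∀ z, z ≠ u → ¬ H.Adj z u → H.degree z = Δ := by
    rw [← card_nonneighborsOfDegree_eq_iff, ← h.card_nonneighborsOfDegree hdeg hG, ← hdeg,
      card_nonneighborsOfDegree_eq_iff]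
    exact hnon
  obtain ⟨φ, hφ, hadj⟩ := h u hu
  have hφu : ∀ z, φ z = u ↔ z = u := fun z => by rw [← φ.apply_eq_iff_eq (x := z) (y := u), hφ]
  -- In both graphs the nonneighbors of `u` are exactly the vertices of degree `Δ` in the card, so
  -- `φ` respects adjacency to `u` and is an isomorphism.
  have key : ∀ z, z ≠ u → (H.Adj (φ z) u ↔ G.Adj z u) := by
    intro z hz
    have h1 := mem_nonneighborsOfDegree_of_perm hG hH hφ hadj z
    have hz' : φ z ≠ u := fun e => hz ((hφu z).1 e)
    have h2 := hnon z hz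
    have h3 := hnon' (φ z) hz'
    simp only [mem_nonneighborsOfDegree] at h1
    tauto
  refine cliqueCount_congr ⟨φ, fun {a b} => ?_⟩ r
  by_cases ha : a = u
  · subst ha
    by_cases hb : b = a
    · subst hb
      simp
    · rw [hφ, adj_comm, key b hb, adj_comm]
  · by_cases hb : b = u
    · subst hb
      rw [hφ, key a ha]
    · exact (hadj a b ha hb).symm

/-- If `v` does not have maximum degree and the vertices of maximum degree have at least two
nonneighbors, then the clique counts agree. -/
theorem CardsAgreeOff.cliqueCount_le_of_degree_lt (h : G.CardsAgreeOff H v)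
    (hdeg : ∀ x, G.degree x = H.degree x) (hG : ∀ u, G.degree u ≤ Δ) (hv : G.degree v < Δ)
    (hne : ∃ u, G.degree u = Δ) (hΔ : Δ + 3 ≤ Fintype.card V) (r : ℕ) :
    G.cliqueCount r ≤ H.cliqueCount r := by
  by_contra! hlt
  have hH : ∀ u, H.degree u ≤ Δ := fun u => hdeg u ▸ hG u
  obtain ⟨u, hu, hmax⟩ := Finset.exists_max_image {u | G.degree u = Δ} (G.cliqueCountAt r)
    (by simpa [Finset.Nonempty] using hne)
  simp only [Finset.mem_filter, Finset.mem_univ, true_and] at hu hmax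
  have hcard := card_nonneighbor_add_degree (G := G) u
  -- Two nonneighbors of `u` guarantee one whose card is available.
  obtain ⟨x, hx, hxv⟩ := Finset.exists_mem_ne (s := {x | x ≠ u ∧ ¬ G.Adj u x}) (by omega) v
  simp only [Finset.mem_filter, Finset.mem_univ, true_and] at hx
  have hmem : u ∈ G.nonneighborsOfDegree Δ x :=
    mem_nonneighborsOfDegree.2 ⟨hx.1.symm, hx.2, hu⟩
  obtain ⟨φ, hφ, hadj⟩ := h x hxv
  have h1 := (mem_nonneighborsOfDegree_of_perm hG hH hφ hadj u).1 hmem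
  have h2 := cliqueCountAt_perm_of_mem hG hH hφ hadj r hmem
  have h3 := (mem_nonneighborsOfDegree.1 h1).2.2
  rw [← hdeg] at h3
  have h4 : φ u ≠ v := by
    intro e
    rw [e] at h3
    omega
  have h5 := h.cliqueCountAt_add r h4
  have h6 := hmax _ h3
  omega

/-- If `v` does not have maximum degree and the vertices of maximum degree have exactly one
nonneighbor, then the clique counts agree. -/
theorem CardsAgreeOff.cliqueCount_eq_of_degree_lt (h : G.CardsAgreeOff H v)
    (hdeg : ∀ x, G.degree x = H.degree x) (hG : ∀ u, G.degree u ≤ Δ) (hv : G.degree v < Δ)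
    (hne : ∃ u, G.degree u = Δ) (hΔ : Δ + 2 = Fintype.card V) (r : ℕ) :
    G.cliqueCount r = H.cliqueCount r := by
  induction r with
  | zero => rw [cliqueCount_zero, cliqueCount_zero]
  | succ r ih =>
    have hrec : ∀ (K : SimpleGraph V) [DecidableRel K.Adj] (u : V), K.degree u = Δ →
        K.cliqueCountAt (r + 1) u + K.cliqueCountAt r u +
          ∑ x with x ≠ u ∧ ¬ K.Adj u x, K.cliqueCountAt r x = K.cliqueCount r := by
      intro K _ u hu
      have hcard := card_nonneighbor_add_degree (G := K) u
      obtain ⟨z, hz⟩ := Finset.card_eq_one.1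
        (show #{x | x ≠ u ∧ ¬ K.Adj u x} = 1 by omega)
      have hz' := Finset.ext_iff.1 hz
      simp only [Finset.mem_filter, Finset.mem_univ, true_and, Finset.mem_singleton] at hz'
      rw [hz, Finset.sum_singleton]
      refine cliqueCountAt_succ_add_of_unique_nonneighbor ((hz' z).2 rfl).1 ((hz' z).2 rfl).2
        fun y hy hyz => ?_
      by_contra hc
      exact hyz ((hz' y).1 ⟨hy, hc⟩)
    have hat : ∀ x, G.cliqueCountAt r x = H.cliqueCountAt r x := by
      intro x
      rcases eq_or_ne x v with rfl | hx
      · have := h.cliqueCountAt_sub_self r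
        rw [ih, sub_self, mul_zero] at this
        omega
      · have := h.cliqueCountAt_add r hx
        omega
    have hsum : ∀ (K : SimpleGraph V) [DecidableRel K.Adj],
        ∑ u with K.degree u = Δ, K.cliqueCountAt (r + 1) u +
          ∑ u with K.degree u = Δ, K.cliqueCountAt r u +
          ∑ x, #(K.nonneighborsOfDegree Δ x) * K.cliqueCountAt r x =
        #{u | K.degree u = Δ} * K.cliqueCount r := by
      intro K _
      have h1 := sum_nonneighborsOfDegree (G := K) (Δ := Δ) fun _ x => K.cliqueCountAt r x
      simp only [Finset.sum_const, smul_eq_mul] at h1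
      rw [h1, ← Finset.sum_add_distrib, ← Finset.sum_add_distrib, ← smul_eq_mul,
        ← Finset.sum_const]
      exact Finset.sum_congr rfl fun u hu => hrec K u (Finset.mem_filter.1 hu).2
    have h1 := hsum G
    have h2 := hsum H
    simp only [hdeg, hat, h.card_nonneighborsOfDegree hdeg hG, ih] at h1
    -- The sums of `(r + 1)`-clique counts over the vertices of degree `Δ` agree by the recursion.
    -- As `v` is not among them, every summand shifts by the same global difference, which must
    -- vanish.
    have h3 : ∑ u with H.degree u = Δ, (G.cliqueCountAt (r + 1) u + H.cliqueCount (r + 1)) =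
        ∑ u with H.degree u = Δ, (H.cliqueCountAt (r + 1) u + G.cliqueCount (r + 1)) := by
      refine Finset.sum_congr rfl fun u hu => h.cliqueCountAt_add (r + 1) ?_
      rintro rfl
      have := (Finset.mem_filter.1 hu).2
      rw [← hdeg] at this
      omega
    simp only [Finset.sum_add_distrib, Finset.sum_const, smul_eq_mul] at h3
    obtain ⟨u, hu⟩ := hne
    rw [hdeg] at hu
    have hpos : 0 < #{u | H.degree u = Δ} := Finset.card_pos.2 ⟨u, by simpa using hu⟩
    refine (Nat.eq_of_mul_eq_mul_left hpos ?_).symm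
    omega

/-- If `v` is adjacent to all other vertices, then the numbers of small cliques agree. -/
theorem CardsAgreeOff.cliqueCount_eq_of_dominating (h : G.CardsAgreeOff H v)
    (hG : ∀ z, z ≠ v → G.Adj v z) (hH : ∀ z, z ≠ v → H.Adj v z) {r : ℕ}
    (hr : r + 2 ≤ Fintype.card V) : G.cliqueCount r = H.cliqueCount r := by
  induction r with
  | zero => rw [cliqueCount_zero, cliqueCount_zero]
  | succ r ih =>
    have ih := ih (by omega)
    have h1 := h.cliqueCountAt_sub_self r
    have h2 := h.cliqueCountAt_sub_self (r + 1)
    have h3 := cliqueCountAt_succ_add_of_dominating (r := r) hG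
    have h4 := cliqueCountAt_succ_add_of_dominating (r := r) hH
    rw [ih, sub_self, mul_zero] at h1
    -- The counts at `v` agree, while their difference is `r + 1 - (n - 1)` times the global one;
    -- that factor is nonzero because `r + 1 ≤ n - 2`.
    have h5 : (G.cliqueCountAt (r + 1) v : ℤ) - H.cliqueCountAt (r + 1) v = 0 := by omega
    rw [h5, zero_eq_mul] at h2
    push_cast at h2
    omega

/-- If `v` has maximum degree and the clique counts differ, then the nonneighbors of `v` all have
maximum degree. -/
theorem CardsAgreeOff.nonneighbors_of_cliqueCount_ne (h : G.CardsAgreeOff H v)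
    (hdeg : ∀ x, G.degree x = H.degree x) (hG : ∀ u, G.degree u ≤ Δ) (hv : G.degree v = Δ)
    (hΔ : Δ + 2 ≤ Fintype.card V) {r : ℕ} (hr : r + #{u | G.degree u = Δ} ≠ Fintype.card V)
    (hne : G.cliqueCount r ≠ H.cliqueCount r) :
    ∀ z, z ≠ v → ¬ G.Adj z v → G.degree z = Δ := by
  have hH : ∀ u, H.degree u ≤ Δ := fun u => hdeg u ▸ hG u
  obtain ⟨D, hD⟩ : ∃ D, D + Δ + 1 = Fintype.card V := ⟨Fintype.card V - Δ - 1, by omega⟩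
  -- The difference of the two sums is `(ℓ - 1) + (r - (n - 1))` times the nonzero global
  -- difference.
  have hsum : (∑ u with G.degree u = Δ, (G.cliqueCountAt r u : ℤ)) ≠
      ∑ u with G.degree u = Δ, (H.cliqueCountAt r u : ℤ) := by
    rw [ne_eq, ← sub_eq_zero, ← Finset.sum_sub_distrib,
      ← Finset.add_sum_erase _ _ (show v ∈ ({u | G.degree u = Δ} : Finset V) by simpa using hv),
      h.cliqueCountAt_sub_self, Finset.sum_congr rfl fun u hu =>
        h.cliqueCountAt_sub r (Finset.ne_of_mem_erase hu), Finset.sum_const,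
      Finset.card_erase_of_mem (by simpa using hv), nsmul_eq_mul,
      Nat.cast_sub (Finset.card_pos.2 ⟨v, by simpa using hv⟩), ← add_mul, mul_eq_zero]
    push_cast
    omega
  obtain ⟨q, hq⟩ : ∃ q, #{u | G.degree u = Δ ∧ G.cliqueCountAt r u = q} ≠
      #{u | G.degree u = Δ ∧ H.cliqueCountAt r u = q} := by
    by_contra! hc
    apply hsum
    have : Multiset.map (G.cliqueCountAt r) ({u | G.degree u = Δ} : Finset V).val =
        Multiset.map (H.cliqueCountAt r) ({u | G.degree u = Δ} : Finset V).val := by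
      ext q
      have := hc q
      rw [← Finset.filter_filter, ← Finset.filter_filter] at this
      simp only [eq_comm (b := q)] at this
      rw [Multiset.count_map, Multiset.count_map]
      exact this
    have := congrArg Multiset.sum this
    exact_mod_cast this
  have h1 := sum_card_filter_nonneighborsOfDegree (G := G) hD fun u => G.cliqueCountAt r u = q
  have h2 := sum_card_filter_nonneighborsOfDegree (G := H) hD fun u => H.cliqueCountAt r u = q
  rw [← Finset.add_sum_erase _ _ (Finset.mem_univ v)] at h1 h2
  rw [Finset.sum_congr rfl fun x hx => h.card_filter_nonneighborsOfDegree hG hH r (· = q)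
    (Finset.ne_of_mem_erase hx)] at h1
  simp only [← hdeg] at h2
  have h3 := Finset.card_filter_le (G.nonneighborsOfDegree Δ v) fun u => G.cliqueCountAt r u = q
  have h4 := Finset.card_filter_le (H.nonneighborsOfDegree Δ v) fun u => H.cliqueCountAt r u = q
  have h5 := h.card_nonneighborsOfDegree hdeg hG v
  have h6 := card_nonneighborsOfDegree_le (G := G) (Δ := Δ) v
  rw [← card_nonneighborsOfDegree_eq_iff]
  -- The two totals are distinct multiples of `D` and differ only in the term at `v`. That term is
  -- therefore at least `D` in one graph, but `v` has only `D` nonneighbors.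
  rcases Nat.lt_or_gt_of_ne hq with hlt | hlt
  · have := Nat.mul_le_mul_left D hlt
    rw [Nat.mul_succ] at this
    omega
  · have := Nat.mul_le_mul_left D hlt
    rw [Nat.mul_succ] at this
    omega

/-- If `v` has maximum degree but is not adjacent to all other vertices, then the clique counts
agree outside the exceptional clique size. -/
theorem CardsAgreeOff.cliqueCount_le_of_degree_eq (h : G.CardsAgreeOff H v)
    (hdeg : ∀ x, G.degree x = H.degree x) (hG : ∀ u, G.degree u ≤ Δ) (hv : G.degree v = Δ)
    (hΔ : Δ + 2 ≤ Fintype.card V) {r : ℕ} (hr : r + #{u | G.degree u = Δ} ≠ Fintype.card V) :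
    G.cliqueCount r ≤ H.cliqueCount r := by
  by_contra! hlt
  have hH : ∀ u, H.degree u ≤ Δ := fun u => hdeg u ▸ hG u
  have hGv := h.nonneighbors_of_cliqueCount_ne hdeg hG hv hΔ hr hlt.ne'
  have hHv := h.symm.nonneighbors_of_cliqueCount_ne (fun x => (hdeg x).symm) hH
    (by rw [← hdeg, hv]) hΔ (by simpa only [← hdeg] using hr) hlt.ne
  have hall : ∀ u, G.degree u = Δ → ∀ z, z ≠ u → ¬ G.Adj z u → G.degree z = Δ := by
    by_contra! hc
    -- The extremal choice is restricted to vertices with a nonneighbor `z` of smaller degree. Then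
    -- `z ≠ v`, and the image of `u` inherits `z` as an `H`-nonneighbor, so it is not `v` either.
    obtain ⟨u, ⟨hu, z, hz⟩, hmax⟩ := Set.exists_max_image
      {u | G.degree u = Δ ∧ ∃ z, z ≠ u ∧ ¬ G.Adj z u ∧ G.degree z ≠ Δ} (G.cliqueCountAt r)
      (Set.toFinite _) hc
    have hzv : z ≠ v := fun e => hz.2.2 (e ▸ hv)
    have hmem : u ∈ G.nonneighborsOfDegree Δ z :=
      mem_nonneighborsOfDegree.2 ⟨hz.1.symm, fun e => hz.2.1 e.symm, hu⟩
    obtain ⟨φ, hφ, hadj⟩ := h z hzv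
    have h1 := (mem_nonneighborsOfDegree_of_perm hG hH hφ hadj u).1 hmem
    have h2 := cliqueCountAt_perm_of_mem hG hH hφ hadj r hmem
    rw [mem_nonneighborsOfDegree] at h1
    have h3 : ¬ ∀ y, y ≠ φ u → ¬ H.Adj y (φ u) → H.degree y = Δ := fun hy =>
      hz.2.2 ((hdeg z).trans (hy z h1.1.symm fun e => h1.2.1 e.symm))
    have h4 : φ u ≠ v := fun e => h3 (e ▸ hHv)
    rw [← card_nonneighborsOfDegree_eq_iff, ← h.card_nonneighborsOfDegree hdeg hG, ← hdeg,
      card_nonneighborsOfDegree_eq_iff] at h3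
    push Not at h3
    have h5 := h.cliqueCountAt_add r h4
    have h6 := hmax (φ u) ⟨(hdeg _).trans h1.2.2, h3⟩
    omega
  have hcard := card_nonneighbor_add_degree (G := G) v
  obtain ⟨u, hu⟩ := Finset.card_pos.1 (show 0 < #{x | x ≠ v ∧ ¬ G.Adj v x} by omega)
  simp only [Finset.mem_filter, Finset.mem_univ, true_and, G.adj_comm v] at hu
  exact hlt.ne' (h.cliqueCount_eq_of_nonneighbors hdeg hG hu.1 (hall u (hGv u hu.1 hu.2)) r)

theorem cliqueCount_eq_zero_of_degree_add_one_lt {r : ℕ} (hr : Fintype.card V ≤ r) {x : V}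
    (hx : G.degree x + 1 < Fintype.card V) : G.cliqueCount r = 0 := by
  rw [cliqueCount, Finset.card_eq_zero]
  refine Finset.eq_empty_of_forall_notMem fun s hs => ?_
  rw [mem_cliqueFinset_iff] at hs
  have h1 : s = Finset.univ := by
    rw [← Finset.card_eq_iff_eq_univ]
    have := s.card_le_univ
    have := hs.card_eq
    omega
  have h2 := card_nonneighbor_add_degree (G := G) x
  obtain ⟨u, hu⟩ := Finset.card_pos.1 (show 0 < #{u | u ≠ x ∧ ¬ G.Adj x u} by omega)
  simp only [Finset.mem_filter, Finset.mem_univ, true_and] at hu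
  exact hu.2 (hs.isClique (by simp [h1]) (by simp [h1]) hu.1.symm)

theorem adj_of_degree_add_one_eq {x : V} (hx : G.degree x + 1 = Fintype.card V) :
    ∀ z, z ≠ x → G.Adj x z := by
  intro z hz
  have h2 := card_nonneighbor_add_degree (G := G) x
  by_contra hc
  have : 0 < #{u | u ≠ x ∧ ¬ G.Adj x u} := Finset.card_pos.2 ⟨z, by simpa using ⟨hz, hc⟩⟩
  omega

theorem CardsAgreeOff.cliqueCount_eq (h : G.CardsAgreeOff H v) (hn : 7 ≤ Fintype.card V) {r : ℕ}
    (hr : r ≠ Fintype.card V - G.numMaxDegree) : G.cliqueCount r = H.cliqueCount r := by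
  have hdeg := h.degree_eq hn
  have hr' : r + #{u | G.degree u = G.maxDegree} ≠ Fintype.card V := by
    rw [numMaxDegree] at hr
    omega
  have hG := G.degree_le_maxDegree
  have : Nonempty V := ⟨v⟩
  have hlt := G.maxDegree_lt_card_verts
  obtain ⟨t, ht⟩ := G.exists_maximal_degree_vertex
  obtain ⟨Δ, hΔ⟩ : ∃ Δ, G.maxDegree = Δ := ⟨_, rfl⟩
  rw [hΔ] at ht hr' hlt
  simp only [hΔ] at hG
  have hH : ∀ u, H.degree u ≤ Δ := fun u => hdeg u ▸ hG u
  have hr'' : r + #{u | H.degree u = Δ} ≠ Fintype.card V := by simpa only [← hdeg] using hr'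
  rcases (hG v).lt_or_eq with hv | hv
  · rcases Nat.lt_trichotomy (Δ + 2) (Fintype.card V) with h2 | h2 | h2
    · exact le_antisymm (h.cliqueCount_le_of_degree_lt hdeg hG hv ⟨t, ht.symm⟩ h2 r)
        (h.symm.cliqueCount_le_of_degree_lt (fun x => (hdeg x).symm) hH (hdeg v ▸ hv)
          ⟨t, by rw [← hdeg, ht]⟩ h2 r)
    · exact h.cliqueCount_eq_of_degree_lt hdeg hG hv ⟨t, ht.symm⟩ h2 r
    · refine h.cliqueCount_eq_of_nonneighbors hdeg hG (u := t) ?_ ?_ r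
      · rintro rfl
        omega
      · intro z hz hzt
        exact absurd (adj_of_degree_add_one_eq (by omega) z hz).symm hzt
  · rcases Nat.lt_or_ge (Fintype.card V) (Δ + 2) with h2 | h2
    · have hGv := adj_of_degree_add_one_eq (G := G) (x := v) (by omega)
      have hHv := adj_of_degree_add_one_eq (G := H) (x := v) (by rw [← hdeg]; omega)
      by_cases hex : ∃ u, u ≠ v ∧ G.degree u = Δ
      · obtain ⟨u, huv, hu⟩ := hex
        refine h.cliqueCount_eq_of_nonneighbors hdeg hG huv ?_ r
        intro z hz hzu
        exact absurd (adj_of_degree_add_one_eq (by omega) z hz).symm hzu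
      -- Now `ℓ = 1`, so the excluded size is `n - 1`: induction covers smaller sizes, and for `r ≥
      -- n` there are no cliques.
      · push Not at hex
        have h1 : #{u | G.degree u = Δ} = 1 := by
          rw [Finset.card_eq_one]
          refine ⟨v, ?_⟩
          ext u
          simp only [Finset.mem_filter, Finset.mem_univ, true_and, Finset.mem_singleton]
          exact ⟨fun hu => by_contra fun hc => hex u hc hu, fun hu => hu ▸ hv⟩
        rw [h1] at hr'
        rcases Nat.lt_or_ge r (Fintype.card V) with h3 | h3
        · exact h.cliqueCount_eq_of_dominating hGv hHv (by omega)
        · have : Nontrivial V := Fintype.one_lt_card_iff_nontrivial.1 (by omega)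
          obtain ⟨x, hx⟩ := exists_ne v
          have h4 := hex x hx
          have h5 := hG x
          rw [cliqueCount_eq_zero_of_degree_add_one_lt h3 (x := x) (by omega),
            cliqueCount_eq_zero_of_degree_add_one_lt h3 (x := x) (by rw [← hdeg]; omega)]
    · exact le_antisymm (h.cliqueCount_le_of_degree_eq hdeg hG hv h2 hr')
        (h.symm.cliqueCount_le_of_degree_eq (fun x => (hdeg x).symm) hH (hdeg v ▸ hv) h2 hr'')

end SimpleGraph

/-! ### From a family of cards to a common vertex set -/

/-- An injection missing exactly one point extends to an equivalence. -/
theorem exists_equiv_option_of_embedding {n : ℕ} (hn : 0 < n) {V : Type*} [Fintype V]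
    (hV : Fintype.card V = n) (f : Fin (n - 1) ↪ V) :
    ∃ e : Option (Fin (n - 1)) ≃ V, ∀ i, e (some i) = f i := by
  classical
  have hcard : Fintype.card (Fin (n - 1)) < Fintype.card V := by
    rw [Fintype.card_fin]
    omega
  obtain ⟨v, hv⟩ : ∃ v, v ∉ Set.range f := by
    by_contra! hc
    have := Fintype.card_le_of_surjective f fun v => hc v
    omega
  have hinj : Function.Injective (fun o : Option (Fin (n - 1)) => o.elim v f) := by
    rintro (_ | i) (_ | j) hij
    · rfl
    · exact absurd ⟨j, hij.symm⟩ hv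
    · exact absurd ⟨i, hij⟩ hv
    · exact congrArg some (f.injective hij)
  refine ⟨Equiv.ofBijective _ ((Fintype.bijective_iff_injective_and_card _).2 ⟨hinj, ?_⟩),
    fun i => rfl⟩
  rw [Fintype.card_option, Fintype.card_fin, hV]
  omega

theorem SimpleGraph.AreCardsOf.exists_cardsAgreeOff {n : ℕ} (hn : 0 < n) {V W : Type*}
    [Fintype V] [Fintype W] (hV : Fintype.card V = n) (hW : Fintype.card W = n)
    {G : SimpleGraph V} {H : SimpleGraph W} {C : Fin (n - 1) → SimpleGraph (Fin (n - 1))}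
    (hG : SimpleGraph.AreCardsOf C G) (hH : SimpleGraph.AreCardsOf C H) :
    ∃ (σ : V ≃ W) (v : V), G.CardsAgreeOff (H.comap σ) v := by
  classical
  obtain ⟨f, hf⟩ := hG
  obtain ⟨g, hg⟩ := hH
  obtain ⟨e, he⟩ := exists_equiv_option_of_embedding hn hV f
  obtain ⟨e', he'⟩ := exists_equiv_option_of_embedding hn hW g
  refine ⟨e.symm.trans e', e none, fun x hx => ?_⟩
  obtain ⟨i, rfl⟩ : ∃ i, f i = x := by
    obtain ⟨o, rfl⟩ := e.surjective x
    cases o with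
    | none => exact absurd rfl hx
    | some i => exact ⟨i, (he i).symm⟩
  have hσ : (e.symm.trans e') (f i) = g i := by
    rw [← he, Equiv.trans_apply, Equiv.symm_apply_apply, he']
  generalize e.symm.trans e' = σ at hσ ⊢
  obtain ⟨α⟩ := hf i
  obtain ⟨β⟩ := hg i
  -- The isomorphism between the two cards, pulled back along `σ`, permutes the complement of `f i`;
  -- `Equiv.Perm.ofSubtype` extends it by fixing `f i`.
  let τ : ({g i}ᶜ : Set W) ≃ ({f i}ᶜ : Set V) := σ.symm.subtypeEquiv fun w => by
    simp [← hσ, Equiv.symm_apply_eq]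
  let π : Equiv.Perm ({f i}ᶜ : Set V) := (α.symm.trans β).toEquiv.trans τ
  have hπ : ∀ a, a ≠ f i → ∃ h : a ∈ ({f i}ᶜ : Set V),
      σ (Equiv.Perm.ofSubtype π a) = (α.symm.trans β) ⟨a, h⟩ := by
    intro a ha
    refine ⟨ha, ?_⟩
    rw [Equiv.Perm.ofSubtype_apply_of_mem π (show a ∈ ({f i}ᶜ : Set V) from ha)]
    simp [π, τ]
  refine ⟨Equiv.Perm.ofSubtype π, Equiv.Perm.ofSubtype_apply_of_not_mem π (by simp),
    fun a b ha hb => ?_⟩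
  obtain ⟨ha', ea⟩ := hπ a ha
  obtain ⟨hb', eb⟩ := hπ b hb
  rw [SimpleGraph.comap_adj, ea, eb]
  exact ((α.symm.trans β).map_rel_iff (a := ⟨a, ha'⟩) (b := ⟨b, hb'⟩)).symm

theorem theorem3 (n : ℕ) (hn : 7 ≤ n) {V : Type*} [Fintype V] [DecidableEq V]
    (hV : Fintype.card V = n) (G : SimpleGraph V) [DecidableRel G.Adj]
    (r : ℕ) (hr : r ≠ n - G.numMaxDegree)
    (C : Fin (n - 1) → SimpleGraph (Fin (n - 1))) (hC : SimpleGraph.AreCardsOf C G)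
    {W : Type*} [Fintype W] [DecidableEq W] (hW : Fintype.card W = n)
    (H : SimpleGraph W) [DecidableRel H.Adj] (hH : SimpleGraph.AreCardsOf C H) :
    H.cliqueCount r = G.cliqueCount r := by
  classical
  obtain ⟨σ, v, h⟩ := hC.exists_cardsAgreeOff (by omega) hV hW hH
  rw [h.cliqueCount_eq (by omega) (by rwa [hV])]
  exact (SimpleGraph.cliqueCount_congr (SimpleGraph.Iso.comap σ H) r).symm
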